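/- **Setting.** Fix $n\ge 101$ and $1\le k<d$. Datasets are tuples $S=(x_1,\dots,x_n)$ of points of the closed Euclidean unit ball $B$ of $\mathbb R^d$, and $d_H$ is the Hamming distance. Let $\lambda_1(S)\ge\dots\ge\lambda_d(S)$ be the eigenvalues of the empirical covariance matrix $\frac1{n-1}\sum_i(x_i-\bar x)(x_i-\bar x)^\top$ with $\bar x=\frac1n\sum_i x_i$, and let $\delta_k(S)=\lambda_k(S)-\lambda_{k+1}(S)$. For every $S$ let $A_k(S)\in\mathbb R^{d\times k}$ have as columns orthonormal eigenvectors for $\lambda_1(S),\dots,\lambda_k(S)$ (any fixed choice, where it is not unique). **Loss.** Let $\mathcal H\subseteq\mathbb R^p$ be nonempty, closed and convex, and let $\mathcal H\subseteq\Theta\subseteq\mathbb R^p$, where $\Theta$ is open; more generally it suffices that at each non-interior point $\theta$ of $\Theta$, $\theta$ is a limit of interior points and $\nabla_\theta\ell(\cdot,x)$ is continuous at $\theta$ along the interior for every $x\in B$. Let $L>0$ and $\mu\in\mathbb R$. For all $\theta,\theta'\in\Theta$ and $x,x'\in B$ the loss $\ell(\cdot,x)$ is differentiable at $\theta$, and $$|\ell(\theta,x)-\ell(\theta',x)|\le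 L\|\theta-\theta'\|_2\quad(L\text{-Lipschitz}),\qquad \|\nabla_\theta\ell(\theta,x)-\nabla_\theta\ell(\theta,x')\|_2\le\mu\|x-x'\|_2\quad(\mu\text{-smooth}).$$ **DP-GD.** On input $D=(z_1,\dots,z_n)$, DP-GD with noise level $\sigma$, step size $\eta\in\mathbb R$ and $T\ge1$ iterations draws $w_0$ from a data-independent probability distribution on $\mathcal H$, sets $$w_{t+1}=\Pi_{\mathcal H}\Bigl(w_t-\eta\Bigl(\tfrac1n\sum_{i=1}^n\nabla_\theta\ell(w_t,z_i)+\xi_t\Bigr)\Bigr),\qquad \xi_t\sim\mathcal N(0,\sigma^2I_p)\text{ independent},\quad 0\le t<T,$$ where $\Pi_{\mathcal H}$ is the Euclidean projection onto $\mathcal H$, and outputs $\frac1T\sum_{t=1}^Tw_t$. **Algorithm.** Given $\varepsilon,\delta,\beta>0$ and a dataset $S$, let $$\Gamma=\min_{S':\,\delta_k(S')<\beta}d_H(S,S')+Z,$$ where $Z$ has the Laplace distribution $\mathrm{Lap}(1/\varepsilon)$ and $S'$ runs over the datasets of size $n$. If $\Gamma\le\frac{\log(2/\delta)}{\varepsilon}$,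 output $\perp$. Otherwise output the result of DP-GD, run with independent randomness and $\sigma=\frac{2L\sqrt T}{\varepsilon n}$, on $\bigl(A_k(S)A_k(S)^\top x_i\bigr)_{i=1}^n$. **Theorem.** If $0<\delta\le\exp\Bigl(-1.05\,\varepsilon^2\bigl(1+\frac{12.2^2\mu^2}{L^2\beta^2}\bigr)\Bigr)$, then the algorithm is $(\widehat\varepsilon+\varepsilon,\delta)$-differentially private on all datasets of size $n$, with $$\widehat\varepsilon=3\varepsilon\sqrt{1.05\Bigl(1+\frac{12.2^2\mu^2}{L^2\beta^2}\Bigr)\log\frac1\delta}.$$ That is, the law $M(S)$ of its output on $S$ is a probability measure on $\mathbb R^p\cup\{\perp\}$, and for any datasets $S,S'$ with $d_H(S,S')=1$ and any measurable set $O$ of outputs, $M(S)(O)\le e^{\widehat\varepsilon+\varepsilon}M(S')(O)+\delta$. -/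

import Mathlib

open MeasureTheory ProbabilityTheory

noncomputable section

namespace PTRPCA

/-- Euclidean space `ℝ^d`. -/
abbrev E (d : ℕ) := EuclideanSpace ℝ (Fin d)

/-- The instance space: the closed Euclidean unit ball of `ℝ^d`. -/
abbrev Instance (d : ℕ) := Metric.closedBall (0 : E d) 1

/-- Datasets of size `n`. -/
abbrev Dataset (n d : ℕ) := Fin n → Instance d

/-! ### Differential privacy -/

/-- The Hamming distance of two tuples: the number of entries in which they differ. -/
def hamming {n : ℕ} {X : Type*} (S S' : Fin n → X) : ℕ :=
  open scoped Classical in hammingDist S S'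

/-- A randomized algorithm on datasets of size `n`, given by the output law `M S` for every input
dataset `S`, is `(ε, δ)`-differentially private. -/
def IsDP {n : ℕ} {X Y : Type*} [MeasurableSpace Y] (M : (Fin n → X) → Measure Y)
    (ε δ : ℝ) : Prop :=
  ∀ S S' : Fin n → X, hamming S S' = 1 → ∀ O : Set Y, MeasurableSet O →
    M S O ≤ ENNReal.ofReal (Real.exp ε) * M S' O + ENNReal.ofReal δ

/-! ### Noise distributions -/

/-- The Laplace distribution `Lap(b)`, with density `exp (-|z| / b) / (2 b)`. -/
def laplace (b : ℝ) : Measure ℝ :=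
  volume.withDensity fun z => ENNReal.ofReal (1 / (2 * b) * Real.exp (-|z| / b))

/-- The isotropic Gaussian distribution `N(0, σ² I)` on `ℝ^p`. -/
def gaussianNoise (p : ℕ) (σ : ℝ) : Measure (E p) :=
  (stdGaussian (E p)).map fun z => σ • z

/-! ### Principal component analysis -/

/-- The empirical mean of a dataset. -/
def sampleMean {n d : ℕ} (S : Dataset n d) : E d :=
  (1 / (n : ℝ)) • ∑ i, (S i : E d)

/-- The empirical covariance matrix `(n - 1)⁻¹ ∑ i, (x_i - m) (x_i - m)ᵀ` of a dataset, `m` being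
its empirical mean, as a linear map of `ℝ^d`. -/
def sampleCov {n d : ℕ} (S : Dataset n d) : E d →ₗ[ℝ] E d :=
  (1 / ((n : ℝ) - 1)) • ∑ i, (InnerProductSpace.rankOne ℝ
    ((S i : E d) - sampleMean S) ((S i : E d) - sampleMean S)).toLinearMap

theorem sampleCov_isSymmetric {n d : ℕ} (S : Dataset n d) : (sampleCov S).IsSymmetric := by
  intro x y
  simp only [sampleCov, LinearMap.smul_apply, LinearMap.sum_apply, ContinuousLinearMap.coe_coe,
    InnerProductSpace.rankOne_apply, inner_smul_left, inner_smul_right, sum_inner, inner_sum]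
  congr 1
  refine Finset.sum_congr rfl fun i _ => ?_
  rw [real_inner_comm x]
  simp [mul_comm]

/-- The eigenvalues `λ_1(S) ≥ … ≥ λ_d(S)` of the covariance matrix with multiplicity, in decreasing
order; the index starts from `0`. -/
def eigval {n d : ℕ} (S : Dataset n d) : Fin d → ℝ :=
  (sampleCov_isSymmetric S).eigenvalues finrank_euclideanSpace_fin

/-- The `k`-th eigen-gap `δ_k(S) = λ_k(S) - λ_{k+1}(S)`, for `1 ≤ k < d`. -/
def eigengap {n d : ℕ} (k : ℕ) (hk : 1 ≤ k) (hkd : k < d) (S : Dataset n d) : ℝ :=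
  eigval S ⟨k - 1, by omega⟩ - eigval S ⟨k, hkd⟩

/-- The columns `a` of `A_k` are the first `k` eigenvectors of the covariance matrix: they are
orthonormal, and the `i`-th one is an eigenvector for the `i`-th largest eigenvalue. -/
def IsTopEigenvectors {n d k : ℕ} (hkd : k < d) (S : Dataset n d) (a : Fin k → E d) : Prop :=
  Orthonormal ℝ a ∧ ∀ i, sampleCov S (a i) = eigval S (Fin.castLE hkd.le i) • a i

/-- The map `x ↦ A_k A_kᵀ x`, where `A_k` has the columns `a`. -/
def pcaRank {d k : ℕ} (a : Fin k → E d) (x : E d) : E d :=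
  ∑ i, inner ℝ (a i) x • a i

/-! ### DP-GD -/

/-- The metric projection onto a set `H` (used for nonempty closed convex sets only, where the
nearest point exists and is unique). -/
def metricProj {p : ℕ} (H : Set (E p)) (w : E p) : E p :=
  Classical.epsilon fun v => v ∈ H ∧ dist w v = Metric.infDist w H

/-- The average gradient at `w` of the loss `ℓ θ x` with respect to the parameter `θ`. -/
def avgGrad {n d p : ℕ} (ℓ : E p → E d → ℝ) (D : Fin n → E d) (w : E p) : E p :=
  (1 / (n : ℝ)) • ∑ i, gradient (fun θ => ℓ θ (D i)) w

/-- The joint law of `(w_t, w_1 + ⋯ + w_t)` in noisy projected gradient descent: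
`w_0` has law `ν` and `w_{t+1} = Π_H (w_t - η g_t)`, where `g_t` is the average gradient at `w_t`
plus fresh Gaussian noise `N(0, σ² I)`. -/
def gdState {n d p : ℕ} (ℓ : E p → E d → ℝ) (H : Set (E p)) (ν : Measure (E p)) (η σ : ℝ)
    (D : Fin n → E d) : ℕ → Measure (E p × E p)
  | 0 => ν.map fun w => (w, 0)
  | t + 1 => (gdState ℓ H ν η σ D t).bind fun s =>
      (gaussianNoise p σ).map fun z =>
        let w := metricProj H (s.1 - η • (avgGrad ℓ D s.1 + z))
        (w, s.2 + w)

/-- The law of the output `(w_1 + ⋯ + w_T) / T` of DP-GD with `T` iterations. -/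
def dpGD {n d p : ℕ} (ℓ : E p → E d → ℝ) (H : Set (E p)) (ν : Measure (E p)) (η σ : ℝ) (T : ℕ)
    (D : Fin n → E d) : Measure (E p) :=
  (gdState ℓ H ν η σ D T).map fun s => (1 / (T : ℝ)) • s.2

/-! ### Propose-test-release -/

/-- The smallest Hamming distance from `S` to a dataset whose `k`-th eigen-gap is below `β`. -/
def gapDist {n d : ℕ} (k : ℕ) (hk : 1 ≤ k) (hkd : k < d) (β : ℝ) (S : Dataset n d) : ℕ :=
  sInf {m | ∃ S' : Dataset n d, eigengap k hk hkd S' < β ∧ hamming S S' = m}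

/-- The output law of propose-test-release for PCA rank reduction on DP-GD; `Sum.inr ()` stands
for the output `⊥`, and `A S` lists the first `k` eigenvectors that are computed from `S`. -/
def ptr {n d p : ℕ} (k : ℕ) (hk : 1 ≤ k) (hkd : k < d) (A : Dataset n d → Fin k → E d)
    (ℓ : E p → E d → ℝ) (L : ℝ) (H : Set (E p)) (ν : Measure (E p)) (η : ℝ) (T : ℕ)
    (ε δ β : ℝ) (S : Dataset n d) : Measure (E p ⊕ Unit) :=
  open scoped Classical in
  (laplace (1 / ε)).bind fun z =>
    if (gapDist k hk hkd β S : ℝ) + z ≤ Real.log (2 / δ) / ε then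
      Measure.dirac (Sum.inr ())
    else
      (dpGD ℓ H ν η (2 * L * √T / (ε * n)) T fun i => pcaRank (A S) (S i)).map Sum.inl

end PTRPCA

end

open PTRPCA

noncomputable section

namespace PTRPCA

open scoped ENNReal

/-! Replacing one data point also changes the projection `A_k A_kᵀ`, hence possibly every input of
DP-GD. The core is therefore a stability bound for PCA, which the propose-test-release step makes
available.

Let `P`, `P'` be the projections of neighbours `S`, `S'`, let `C`, `C'` be their covariances, let
`f` be the Hilbert–Schmidt norm of `P - P'`, and suppose that `S` has gap at least `β`. Ky Fan's
principle with a gap gives `β f² / 2 ≤ tr ((P - P') C)`, and optimality of `P'` for `C'` gives `tr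
((P - P') C') ≤ 0`. Since `C - C' = (u uᵀ - v vᵀ) / n` with `‖u‖, ‖v‖ ≤ 2`, it follows that `β f² /
2 ≤ 8 f / n`, so `f ≤ 16 / (n β)`; no gap of `S'` is needed (`norm_pcaRank_sub_le`). Hence the
average gradients differ by at most `Δ = 2L/n + 16μ/(nβ)`.

Each step of DP-GD post-processes a Gaussian whose mean moves by at most `Δ/σ` standard deviations.
Rényi bounds, used in their dual Hölder form, compose along the chain (`HolderDominated.bind`) to
the budget `ρ = T (Δ/σ)² / 2 = ε² (1 + 8μ/(Lβ))² / 2`, and `HolderDominated.approx_dp` converts this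
to approximate privacy.

The tested distance is 1-Lipschitz, so the Laplace test costs `ε`. If the distance is `0`, a release
is too rare to matter; otherwise `S` has the gap and the bound above applies. The two cases exclude
each other, so `δ` is paid only once (`isDP_ptr`). -/

/-- `P` is dominated by `Q` in the sense of Hölder's inequality. For `q = α / (α - 1)` this is the
dual form of the bound `∫ (dP/dQ) ^ α dQ ≤ C ^ α`, that is of a bound on the Rényi divergence of
order `α`. -/
def HolderDominated {X : Type*} [MeasurableSpace X] (P Q : Measure X) (q : ℝ) (C : ℝ≥0∞) : Prop :=
  ∀ h : X → ℝ≥0∞, Measurable h → ∫⁻ x, h x ∂P ≤ C * (∫⁻ x, h x ^ q ∂Q) ^ (1 / q)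

/-! ### Hölder domination: post-processing, composition, conversion to approximate privacy -/

namespace HolderDominated

variable {X Y : Type*} [MeasurableSpace X] [MeasurableSpace Y] {P Q : Measure X} {q : ℝ}
  {C C' : ℝ≥0∞}

theorem mono (h : HolderDominated P Q q C) (hC : C ≤ C') : HolderDominated P Q q C' :=
  fun f hf => (h f hf).trans (by gcongr)

theorem refl [IsProbabilityMeasure P] (hq : 1 ≤ q) : HolderDominated P P q 1 := by
  intro f hf
  rcases hq.eq_or_lt with rfl | hq
  · simp
  · have := ENNReal.lintegral_mul_le_Lp_mul_Lq P
      (Real.HolderConjugate.conjExponent hq) hf.aemeasurable (aemeasurable_const (b := 1))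
    simpa using this

theorem map (h : HolderDominated P Q q C) {g : X → Y} (hg : Measurable g) :
    HolderDominated (P.map g) (Q.map g) q C := by
  intro f hf
  rw [lintegral_map hf hg, lintegral_map (hf.pow_const q) hg]
  exact h _ (hf.comp hg)

/-- Adaptive composition: the inner bound leaves the test function `(∫ f ^ q dK') ^ (1/q)`, whose
`q`-th power is just the inner integral, so the outer bound reassembles `Q.bind K'`. The kernels
need to be comparable only `P`-almost everywhere. -/
theorem bind (h : HolderDominated P Q q C) (hq : 0 < q) (hC' : C' ≠ ∞) {K K' : X → Measure Y}
    (hK : Measurable K) (hK' : Measurable K')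
    (hKK' : ∀ᵐ x ∂P, HolderDominated (K x) (K' x) q C') :
    HolderDominated (P.bind K) (Q.bind K') q (C * C') := by
  intro f hf
  rw [Measure.lintegral_bind hK.aemeasurable hf.aemeasurable,
    Measure.lintegral_bind hK'.aemeasurable (hf.pow_const q).aemeasurable]
  have hm : Measurable fun x => ∫⁻ y, f y ^ q ∂K' x :=
    (Measure.measurable_lintegral (hf.pow_const q)).comp hK'
  calc ∫⁻ x, ∫⁻ y, f y ∂K x ∂P ≤ ∫⁻ x, C' * (∫⁻ y, f y ^ q ∂K' x) ^ (1 / q) ∂P :=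
        lintegral_mono_ae (hKK'.mono fun x hx => hx f hf)
    _ = C' * ∫⁻ x, (∫⁻ y, f y ^ q ∂K' x) ^ (1 / q) ∂P := lintegral_const_mul' _ _ hC'
    _ ≤ C' * (C * (∫⁻ x, ((∫⁻ y, f y ^ q ∂K' x) ^ (1 / q)) ^ q ∂Q) ^ (1 / q)) := by
        gcongr
        exact h _ (hm.pow_const _)
    _ = _ := by
        simp_rw [← ENNReal.rpow_mul, one_div_mul_cancel hq.ne', ENNReal.rpow_one]
        ring

theorem prod {P' Q' : Measure Y} [SFinite P'] [SFinite Q'] [SFinite P] [SFinite Q]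
    (h : HolderDominated P Q q C) (h' : HolderDominated P' Q' q C') (hq : 0 < q) (hC' : C' ≠ ∞) :
    HolderDominated (P.prod P') (Q.prod Q') q (C * C') := by
  rw [Measure.prod, Measure.prod]
  exact h.bind hq hC' Measurable.map_prodMk_left Measurable.map_prodMk_left
    (Filter.Eventually.of_forall fun _ => h'.map measurable_prodMk_left)

theorem pi {m : ℕ} {P Q : Fin m → Measure X} [∀ i, IsProbabilityMeasure (P i)]
    [∀ i, IsProbabilityMeasure (Q i)] (hq : 1 ≤ q) {C : Fin m → ℝ≥0∞} (hC : ∀ i, C i ≠ ∞)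
    (h : ∀ i, HolderDominated (P i) (Q i) q (C i)) :
    HolderDominated (Measure.pi P) (Measure.pi Q) q (∏ i, C i) := by
  induction m with
  | zero =>
    rw [Subsingleton.elim P Q]
    simpa using refl hq
  | succ m ih =>
    have e := (measurePreserving_piFinSuccAbove P 0).symm
    have e' := (measurePreserving_piFinSuccAbove Q 0).symm
    rw [← e.map_eq, ← e'.map_eq, Fin.prod_univ_succ]
    refine (prod (h 0) (ih (fun i => hC i.succ) fun i => h i.succ) (by linarith) ?_).map
      (MeasurableEquiv.measurable _)
    exact ENNReal.prod_ne_top fun i _ => hC i.succ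

/-- The Rényi order is `1 + r`. The choice of `r` balances the cost: with `l = log (1/δ)` and `s =
√(ρ l)` one has `r ρ = s` and `r s = l`. -/
theorem approx_dp {ρ δ r : ℝ}
    (hρ : 0 < ρ) (hδ : 0 < δ) (hρδ : ρ ≤ Real.log (1 / δ)) (hr : r = √(Real.log (1 / δ) / ρ))
    (h : HolderDominated P Q (1 + 1 / r) (ENNReal.ofReal (Real.exp (r * ρ))))
    {O : Set X} (hO : MeasurableSet O) :
    P O ≤ ENNReal.ofReal (Real.exp (3 * √(ρ * Real.log (1 / δ)))) * Q O + ENNReal.ofReal δ := by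
  set l := Real.log (1 / δ) with hl
  have hl0 : 0 < l := hρ.trans_le hρδ
  have hr0 : 0 < r := hr ▸ Real.sqrt_pos.2 (by positivity)
  have hδl : δ = Real.exp (-l) := by rw [hl, one_div, Real.log_inv, neg_neg, Real.exp_log hδ]
  set s := √(ρ * l) with hs
  have hrρ : r * ρ = s := by
    rw [hr, hs, Real.sqrt_div hl0.le, Real.sqrt_mul hρ.le]
    field_simp
    rw [Real.sq_sqrt hρ.le]
  have hss : s * s = ρ * l := Real.mul_self_sqrt (by positivity)
  have hrs : r * s = l := by
    have : r * s * ρ = l * ρ := by rw [mul_right_comm, hrρ, hss, mul_comm]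
    exact mul_right_cancel₀ hρ.ne' this
  -- Domination tested on the indicator of `O`; the exponent is `1/q = r/(1+r)`.
  have key : P O ≤ ENNReal.ofReal (Real.exp s) * Q O ^ (r / (1 + r)) := by
    have := h (O.indicator 1) (measurable_one.indicator hO)
    have hq : 0 < 1 + 1 / r := by positivity
    have e1 : (fun x => O.indicator (1 : X → ℝ≥0∞) x ^ (1 + 1 / r)) = O.indicator 1 := by
      ext x
      by_cases hx : x ∈ O
      · simp [hx]
      · simp [hx, ENNReal.zero_rpow_of_pos hq, -one_div]
    rw [e1, lintegral_indicator_one hO, lintegral_indicator_one hO, hrρ] at this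
    convert this using 3
    field_simp
    ring
  by_cases hQt : Q O = ∞
  · rw [hQt, ENNReal.mul_top (by simp [Real.exp_pos])]
    simp
  obtain ⟨y, hy0, hy⟩ : ∃ y : ℝ, 0 ≤ y ∧ Q O = ENNReal.ofReal y :=
    ⟨(Q O).toReal, ENNReal.toReal_nonneg, (ENNReal.ofReal_toReal hQt).symm⟩
  rw [hy, ENNReal.ofReal_rpow_of_nonneg hy0 (by positivity),
    ← ENNReal.ofReal_mul (Real.exp_pos _).le] at key
  rw [hy, ← ENNReal.ofReal_mul (Real.exp_pos _).le, ← ENNReal.ofReal_add (by positivity) hδ.le]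
  refine key.trans (ENNReal.ofReal_le_ofReal ?_)
  rcases hy0.eq_or_lt with rfl | hy0
  · rw [Real.zero_rpow (by positivity)]
    simpa using hδ.le
  obtain ⟨u, rfl⟩ : ∃ u, y = Real.exp u := ⟨Real.log y, (Real.exp_log hy0).symm⟩
  rw [← Real.exp_mul, ← Real.exp_add, ← Real.exp_add, hδl]
  have h1r : 0 < 1 + r := by positivity
  -- Either the bound on `P O` is already at most `δ`, or `Q O = exp u` is not too small: `u ≥ -(ρ +
  -- 2s + l)`. Since `ρ ≤ l`, this is at least `-2s(1 + r)`, so replacing `u r/(1+r)` by `u` costs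
  -- at most `2s`; this is the source of the factor 3.
  rcases le_total (s + u * (r / (1 + r))) (-l) with hc | hc
  · have := Real.exp_le_exp.2 hc
    linarith [Real.exp_pos (3 * s + u)]
  · have hb : 0 ≤ (s + u * (r / (1 + r)) + l) * (1 + r) := by
      apply mul_nonneg _ h1r.le
      linarith
    have hd : (s + u * (r / (1 + r))) ≤ 3 * s + u := by
      rw [← sub_nonneg]
      have e : (3 * s + u - (s + u * (r / (1 + r)))) = (2 * s + 2 * r * s + u) / (1 + r) := by
        field_simp; ring
      rw [e]
      apply div_nonneg _ h1r.le
      have e2 : (s + u * (r / (1 + r)) + l) * (1 + r) = s + r * s + u * r + l * (1 + r) := by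
        field_simp
      rw [e2] at hb
      have e3 : s + r * s + u * r + l * (1 + r) = r * (ρ + 2 * s + u + l) := by
        linear_combination -hrρ - hrs
      have := nonneg_of_mul_nonneg_right (e3 ▸ hb) hr0
      nlinarith
    have := Real.exp_le_exp.2 hd
    linarith [Real.exp_pos (-l)]

end HolderDominated

/-! ### Shifted Gaussians -/

theorem gaussianPDF_shift (a x : ℝ) :
    gaussianPDF a 1 x = gaussianPDF 0 1 x * ENNReal.ofReal (Real.exp (a * x - a ^ 2 / 2)) := by
  rw [gaussianPDF, gaussianPDF, ← ENNReal.ofReal_mul (gaussianPDFReal_nonneg _ _ _)]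
  congr 1
  simp only [gaussianPDFReal, mul_assoc, ← Real.exp_add]
  congr 2
  simp
  ring

theorem lintegral_exp_gaussianReal (a α : ℝ) :
    ∫⁻ x, ENNReal.ofReal (Real.exp (α * (a * x - a ^ 2 / 2))) ∂gaussianReal 0 1
      = ENNReal.ofReal (Real.exp (α * (α - 1) * a ^ 2 / 2)) := by
  have hm := congrFun (mgf_id_gaussianReal (μ := 0) (v := 1)) (α * a)
  rw [mgf] at hm
  have hi := (integrable_exp_mul_gaussianReal (μ := 0) (v := 1) (α * a)).const_mul
    (Real.exp (-(α * a ^ 2 / 2)))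
  have he : ∀ x, Real.exp (α * (a * x - a ^ 2 / 2))
      = Real.exp (-(α * a ^ 2 / 2)) * Real.exp (α * a * x) := fun x => by
    rw [← Real.exp_add]; ring_nf
  simp_rw [he]
  rw [← ofReal_integral_eq_lintegral_ofReal hi
    (Filter.Eventually.of_forall fun x => by positivity), integral_const_mul]
  simp only [id] at hm
  rw [hm, ← Real.exp_add]
  simp only [NNReal.coe_one]
  ring_nf

/-- Hölder's inequality for the likelihood ratio `g` with exponents `1 + r` and `1 + 1/r`; the norm
of `g` comes from the Gaussian moment generating function. -/
theorem holderDominated_gaussianReal (a : ℝ) {r : ℝ} (hr : 0 < r) :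
    HolderDominated (gaussianReal a 1) (gaussianReal 0 1) (1 + 1 / r)
      (ENNReal.ofReal (Real.exp (r * (a ^ 2 / 2)))) := by
  intro h hh
  set g : ℝ → ℝ≥0∞ := fun x => ENNReal.ofReal (Real.exp (a * x - a ^ 2 / 2)) with hg
  have hgm : Measurable g := by fun_prop
  have hpq : (1 + r).HolderConjugate (1 + 1 / r) := by
    rw [Real.holderConjugate_iff]
    constructor
    · linarith
    · field_simp
      ring
  have h1 : ∫⁻ x, h x ∂gaussianReal a 1 = ∫⁻ x, (g * h) x ∂gaussianReal 0 1 := by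
    rw [gaussianReal_of_var_ne_zero _ one_ne_zero, gaussianReal_of_var_ne_zero _ one_ne_zero,
      lintegral_withDensity_eq_lintegral_mul _ (measurable_gaussianPDF _ _) hh,
      lintegral_withDensity_eq_lintegral_mul _ (measurable_gaussianPDF _ _) (hgm.mul hh)]
    refine lintegral_congr fun x => ?_
    simp only [Pi.mul_apply, gaussianPDF_shift a x, hg, mul_assoc]
  rw [h1]
  refine (ENNReal.lintegral_mul_le_Lp_mul_Lq _ hpq hgm.aemeasurable hh.aemeasurable).trans_eq ?_
  congr 1
  simp only [hg]
  simp_rw [ENNReal.ofReal_rpow_of_pos (Real.exp_pos _), ← Real.exp_mul, mul_comm _ (1 + r)]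
  rw [lintegral_exp_gaussianReal, ENNReal.ofReal_rpow_of_pos (Real.exp_pos _), ← Real.exp_mul]
  congr 2
  field_simp
  ring

theorem holderDominated_stdGaussian_add {p : ℕ} (a : E p) {r : ℝ} (hr : 0 < r) :
    HolderDominated ((stdGaussian (E p)).map fun z => z + a) (stdGaussian (E p)) (1 + 1 / r)
      (ENNReal.ofReal (Real.exp (r * (‖a‖ ^ 2 / 2)))) := by
  have hq : 1 ≤ 1 + 1 / r := by linarith [one_div_pos.2 hr]
  have key := (HolderDominated.pi (m := p) (P := fun i => gaussianReal (a i) 1)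
    (Q := fun _ => gaussianReal 0 1) hq (fun i => ENNReal.ofReal_ne_top)
    fun i => holderDominated_gaussianReal (a i) hr).map (g := WithLp.toLp 2)
    (WithLp.measurable_toLp 2 _)
  rw [map_pi_eq_stdGaussian] at key
  convert key using 1
  · rw [← map_pi_eq_stdGaussian, Measure.map_map (by fun_prop) (by fun_prop)]
    have h : ∀ i, gaussianReal (a i) 1 = (gaussianReal 0 1).map fun x => x + a i := fun i => by
      rw [gaussianReal_map_add_const, zero_add]
    simp_rw [h]
    rw [← Measure.pi_map_pi (fun i => by fun_prop),
      Measure.map_map (by fun_prop) (by fun_prop)]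
    rfl
  · rw [← ENNReal.ofReal_prod_of_nonneg fun i _ => (Real.exp_pos _).le, ← Real.exp_sum,
      EuclideanSpace.real_norm_sq_eq, Finset.sum_div, Finset.mul_sum]

/-! ### Projection onto a closed convex set -/

section MetricProjection

variable {p : ℕ} {H : Set (E p)}

theorem metricProj_spec (hHc : IsClosed H) (hHne : H.Nonempty) (w : E p) :
    metricProj H w ∈ H ∧ dist w (metricProj H w) = Metric.infDist w H := by
  obtain ⟨v, hv, h⟩ := hHc.exists_infDist_eq_dist hHne w
  exact Classical.epsilon_spec (p := fun v => v ∈ H ∧ dist w v = Metric.infDist w H) ⟨v, hv, h.symm⟩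

theorem inner_sub_metricProj_nonpos (hHc : IsClosed H) (hHconv : Convex ℝ H) (hHne : H.Nonempty)
    (w : E p) {v : E p} (hv : v ∈ H) :
    inner ℝ (w - metricProj H w) (v - metricProj H w) ≤ 0 := by
  obtain ⟨hm, hd⟩ := metricProj_spec hHc hHne w
  refine (norm_eq_iInf_iff_real_inner_le_zero hHconv hm).1 ?_ v hv
  rw [← dist_eq_norm, hd, Metric.infDist_eq_iInf]
  simp_rw [dist_eq_norm]

/-- Add the variational inequalities at the two projections and apply Cauchy–Schwarz. The result
serves only to make the transitions measurable. -/
theorem lipschitzWith_metricProj (hHc : IsClosed H) (hHconv : Convex ℝ H) (hHne : H.Nonempty) :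
    LipschitzWith 1 (metricProj H) := by
  refine LipschitzWith.of_dist_le_mul fun w w' => ?_
  rw [NNReal.coe_one, one_mul, dist_eq_norm, dist_eq_norm]
  set u := metricProj H w
  set u' := metricProj H w'
  have h1 : inner ℝ (w - u) (u' - u) ≤ 0 :=
    inner_sub_metricProj_nonpos hHc hHconv hHne w (metricProj_spec hHc hHne w').1
  have h2 : inner ℝ (w' - u') (u - u') ≤ 0 :=
    inner_sub_metricProj_nonpos hHc hHconv hHne w' (metricProj_spec hHc hHne w).1
  have h3 : ‖u - u'‖ * ‖u - u'‖ ≤ ‖w - w'‖ * ‖u - u'‖ := by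
    refine le_trans ?_ (real_inner_le_norm (w - w') (u - u'))
    rw [← real_inner_self_eq_norm_mul_norm]
    have e : inner ℝ (w - w') (u - u') - inner ℝ (u - u') (u - u')
        = -inner ℝ (w - u) (u' - u) - inner ℝ (w' - u') (u - u') := by
      rw [← inner_sub_left, ← neg_sub u u', inner_neg_right, neg_neg, ← inner_sub_left]
      congr 1
      abel
    linarith
  rcases (norm_nonneg (u - u')).eq_or_lt with h | h
  · rw [← h]; positivity
  · exact le_of_mul_le_mul_right h3 h

theorem measurable_metricProj (hHc : IsClosed H) (hHconv : Convex ℝ H) (hHne : H.Nonempty) :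
    Measurable (metricProj H) :=
  (lipschitzWith_metricProj hHc hHconv hHne).continuous.measurable

end MetricProjection

/-! ### Noisy gradient descent as a Markov chain -/

theorem measurable_gradient {p : ℕ} (f : E p → ℝ) : Measurable (gradient f) :=
  (InnerProductSpace.toDual ℝ (E p)).symm.continuous.measurable.comp (measurable_fderiv ℝ f)

variable {n d p : ℕ} {H : Set (E p)}

@[fun_prop]
theorem measurable_avgGrad (ℓ : E p → E d → ℝ) (D : Fin n → E d) : Measurable (avgGrad ℓ D) := by
  have h : Measurable fun w => ∑ i, gradient (fun θ => ℓ θ (D i)) w :=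
    Finset.measurable_sum _ fun _ _ => measurable_gradient _
  exact h.const_smul (1 / (n : ℝ))

/-- One step of projected gradient descent on the pair of the current iterate and the sum of the
iterates, for the (noisy) gradient `g`. -/
def gdStep (H : Set (E p)) (η : ℝ) (s : E p × E p) (g : E p) : E p × E p :=
  (metricProj H (s.1 - η • g), s.2 + metricProj H (s.1 - η • g))

theorem Measurable.gdStep {X : Type*} [MeasurableSpace X] (hH : Measurable (metricProj H)) (η : ℝ)
    {s : X → E p × E p} {g : X → E p} (hs : Measurable s) (hg : Measurable g) :
    Measurable fun x => gdStep H η (s x) (g x) := by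
  have h : Measurable fun x => metricProj H ((s x).1 - η • g x) := hH.comp (by fun_prop)
  exact h.prodMk (by fun_prop)

/-- The transition kernel of noisy projected gradient descent. -/
def gdKernel (ℓ : E p → E d → ℝ) (H : Set (E p)) (η σ : ℝ) (D : Fin n → E d) (s : E p × E p) :
    Measure (E p × E p) :=
  (stdGaussian (E p)).map fun z => gdStep H η s (avgGrad ℓ D s.1 + σ • z)

variable (ℓ : E p → E d → ℝ) (η σ : ℝ) (D : Fin n → E d)

theorem measurable_gdKernel (hH : Measurable (metricProj H)) : Measurable (gdKernel ℓ H η σ D) := by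
  have hm : Measurable fun x : (E p × E p) × E p =>
      gdStep H η x.1 (avgGrad ℓ D x.1.1 + σ • x.2) :=
    Measurable.gdStep hH η (by fun_prop) (by fun_prop)
  have he : gdKernel ℓ H η σ D = fun s => ((stdGaussian (E p)).map (Prod.mk s)).map
      fun x : (E p × E p) × E p => gdStep H η x.1 (avgGrad ℓ D x.1.1 + σ • x.2) := by
    funext s
    rw [Measure.map_map hm (by fun_prop), gdKernel]
    rfl
  rw [he]
  exact (Measure.measurable_map _ hm).comp Measurable.map_prodMk_left

theorem isProbabilityMeasure_gdKernel (hH : Measurable (metricProj H)) (s : E p × E p) :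
    IsProbabilityMeasure (gdKernel ℓ H η σ D s) :=
  Measure.isProbabilityMeasure_map
    (Measurable.gdStep hH η (by fun_prop) (by fun_prop)).aemeasurable

theorem gdState_succ (hH : Measurable (metricProj H)) (ν : Measure (E p)) (t : ℕ) :
    gdState ℓ H ν η σ D (t + 1) = (gdState ℓ H ν η σ D t).bind (gdKernel ℓ H η σ D) := by
  rw [gdState]
  congr 1
  funext s
  have hm : Measurable fun z => gdStep H η s (avgGrad ℓ D s.1 + z) :=
    Measurable.gdStep hH η (by fun_prop) (by fun_prop)
  exact Measure.map_map hm (measurable_const_smul σ)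

theorem isProbabilityMeasure_gdState (hH : Measurable (metricProj H)) (ν : Measure (E p)) [IsProbabilityMeasure ν] (t : ℕ) :
    IsProbabilityMeasure (gdState ℓ H ν η σ D t) := by
  induction t with
  | zero => exact Measure.isProbabilityMeasure_map (by fun_prop)
  | succ t ih =>
    rw [gdState_succ ℓ η σ D hH]
    exact isProbabilityMeasure_bind (measurable_gdKernel ℓ η σ D hH).aemeasurable
      (Filter.Eventually.of_forall (isProbabilityMeasure_gdKernel ℓ η σ D hH))

theorem isProbabilityMeasure_dpGD (hH : Measurable (metricProj H)) (ν : Measure (E p)) [IsProbabilityMeasure ν] (T : ℕ) :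
    IsProbabilityMeasure (dpGD ℓ H ν η σ T D) :=
  have := isProbabilityMeasure_gdState ℓ η σ D hH ν T
  Measure.isProbabilityMeasure_map (by fun_prop)

/-- The gradient sensitivity is controlled only on `H`, so composition needs the iterates to lie
there almost surely. -/
theorem ae_gdState_mem (ℓ : E p → E d → ℝ) (hHc : IsClosed H) (hHne : H.Nonempty)
    (hH : Measurable (metricProj H)) (ν : Measure (E p)) (hν : ∀ᵐ w ∂ν, w ∈ H) (η σ : ℝ)
    (D : Fin n → E d) (t : ℕ) : ∀ᵐ s ∂gdState ℓ H ν η σ D t, s.1 ∈ H := by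
  have hs : MeasurableSet {s : E p × E p | s.1 ∈ H} := measurable_fst hHc.measurableSet
  cases t with
  | zero => exact (ae_map_iff (by fun_prop) hs).2 hν
  | succ t =>
    rw [gdState_succ ℓ η σ _ hH, ae_iff, ← Set.compl_ofPred, Measure.bind_apply hs.compl
      (measurable_gdKernel ℓ η σ D hH).aemeasurable]
    refine (lintegral_congr fun s => ?_).trans lintegral_zero
    rw [gdKernel, Measure.map_apply (Measurable.gdStep hH η (by fun_prop) (by fun_prop))
      hs.compl]
    convert measure_empty (μ := stdGaussian (E p))
    ext z
    simpa [gdStep] using (metricProj_spec hHc hHne _).1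

/-- The step on `D` is the step on `D'` with its standard Gaussian shifted by `a`; the rest is
post-processing. -/
theorem holderDominated_gdKernel (ℓ : E p → E d → ℝ)
    (hH : Measurable (metricProj H)) (η : ℝ) {σ : ℝ} (hσ : 0 < σ) (D D' : Fin n → E d)
    (s : E p × E p) {Δ : ℝ} (hΔ : ‖avgGrad ℓ D s.1 - avgGrad ℓ D' s.1‖ ≤ Δ) {r : ℝ} (hr : 0 < r) :
    HolderDominated (gdKernel ℓ H η σ D s) (gdKernel ℓ H η σ D' s) (1 + 1 / r)
      (ENNReal.ofReal (Real.exp (r * ((Δ / σ) ^ 2 / 2)))) := by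
  set a := σ⁻¹ • (avgGrad ℓ D s.1 - avgGrad ℓ D' s.1) with ha
  have hm : Measurable fun z => gdStep H η s (avgGrad ℓ D' s.1 + σ • z) :=
    Measurable.gdStep hH η (by fun_prop) (by fun_prop)
  have key := (holderDominated_stdGaussian_add a hr).map hm
  rw [Measure.map_map hm (by fun_prop)] at key
  have e : ((fun z => gdStep H η s (avgGrad ℓ D' s.1 + σ • z)) ∘ fun z => z + a)
      = fun z => gdStep H η s (avgGrad ℓ D s.1 + σ • z) := by
    funext z
    simp only [Function.comp_apply, ha, smul_add, smul_smul, mul_inv_cancel₀ hσ.ne', one_smul]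
    congr 1
    abel
  rw [e] at key
  refine key.mono (ENNReal.ofReal_le_ofReal (Real.exp_le_exp.2 ?_))
  have : ‖a‖ ≤ Δ / σ := by
    rw [ha, norm_smul, norm_inv, Real.norm_of_nonneg hσ.le, inv_mul_eq_div]
    gcongr
  gcongr

theorem holderDominated_gdState (ℓ : E p → E d → ℝ) (hHc : IsClosed H) (hHne : H.Nonempty)
    (hH : Measurable (metricProj H)) (ν : Measure (E p)) [IsProbabilityMeasure ν]
    (hν : ∀ᵐ w ∂ν, w ∈ H) (η : ℝ) {σ : ℝ} (hσ : 0 < σ) (D D' : Fin n → E d) {Δ : ℝ}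
    (hΔ : ∀ w ∈ H, ‖avgGrad ℓ D w - avgGrad ℓ D' w‖ ≤ Δ) {r : ℝ} (hr : 0 < r) (t : ℕ) :
    HolderDominated (gdState ℓ H ν η σ D t) (gdState ℓ H ν η σ D' t) (1 + 1 / r)
      (ENNReal.ofReal (Real.exp (r * (t * ((Δ / σ) ^ 2 / 2))))) := by
  have hq : 1 ≤ 1 + 1 / r := by linarith [one_div_pos.2 hr]
  induction t with
  | zero =>
    have := isProbabilityMeasure_gdState ℓ η σ D hH ν 0
    rw [Nat.cast_zero, zero_mul, mul_zero, Real.exp_zero, ENNReal.ofReal_one]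
    exact HolderDominated.refl (P := gdState ℓ H ν η σ D 0) hq
  | succ t ih =>
    rw [gdState_succ ℓ η σ _ hH, gdState_succ ℓ η σ _ hH]
    have := ih.bind (by linarith) ENNReal.ofReal_ne_top
      (measurable_gdKernel ℓ η σ D hH) (measurable_gdKernel ℓ η σ D' hH)
      ((ae_gdState_mem ℓ hHc hHne hH ν hν η σ D t).mono fun s hs =>
        holderDominated_gdKernel ℓ hH η hσ D D' s (hΔ _ hs) hr)
    rw [← ENNReal.ofReal_mul (Real.exp_pos _).le, ← Real.exp_add] at this
    convert this using 3
    push_cast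
    ring

theorem dpGD_approx_dp (ℓ : E p → E d → ℝ) (hHc : IsClosed H) (hHne : H.Nonempty)
    (hH : Measurable (metricProj H)) (ν : Measure (E p)) [IsProbabilityMeasure ν]
    (hν : ∀ᵐ w ∂ν, w ∈ H) (η : ℝ) {σ : ℝ} (hσ : 0 < σ) (T : ℕ) (D D' : Fin n → E d) {Δ : ℝ}
    (hΔ : ∀ w ∈ H, ‖avgGrad ℓ D w - avgGrad ℓ D' w‖ ≤ Δ) {ρ δ : ℝ}
    (hρΔ : T * ((Δ / σ) ^ 2 / 2) ≤ ρ) (hρ : 0 < ρ) (hδ : 0 < δ) (hρδ : ρ ≤ Real.log (1 / δ))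
    {O : Set (E p)} (hO : MeasurableSet O) :
    dpGD ℓ H ν η σ T D O ≤ ENNReal.ofReal (Real.exp (3 * √(ρ * Real.log (1 / δ))))
      * dpGD ℓ H ν η σ T D' O + ENNReal.ofReal δ := by
  have hr : 0 < √(Real.log (1 / δ) / ρ) := Real.sqrt_pos.2 (div_pos (hρ.trans_le hρδ) hρ)
  refine HolderDominated.approx_dp hρ hδ hρδ rfl ?_ hO
  refine ((holderDominated_gdState ℓ hHc hHne hH ν hν η hσ D D' hΔ hr T).map
    (by fun_prop)).mono ?_
  gcongr

/-! ### Distance of projections -/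

section ProjectionDistance

variable {d k : ℕ}

/-- The trace `tr (P Q)` of the product of the projections onto the spans of two orthonormal
families. -/
def overlap {k k' : ℕ} (a : Fin k → E d) (b : Fin k' → E d) : ℝ :=
  ∑ j, ∑ l, inner ℝ (a j) (b l) ^ 2

theorem inner_pcaRank (a : Fin k → E d) (x y : E d) :
    inner ℝ (pcaRank a x) y = ∑ j, inner ℝ (a j) x * inner ℝ (a j) y := by
  simp [pcaRank, sum_inner, inner_smul_left]

theorem inner_pcaRank_self (a : Fin k → E d) (x : E d) :
    inner ℝ (pcaRank a x) x = ∑ j, inner ℝ (a j) x ^ 2 := by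
  simp_rw [inner_pcaRank, sq]

theorem inner_pcaRank_comm (a : Fin k → E d) (x y : E d) :
    inner ℝ (pcaRank a x) y = inner ℝ x (pcaRank a y) := by
  rw [real_inner_comm (pcaRank a y), inner_pcaRank, inner_pcaRank]
  simp_rw [mul_comm]

theorem sum_sq_inner_le {a : Fin k → E d} (ha : Orthonormal ℝ a) (x : E d) :
    ∑ j, inner ℝ (a j) x ^ 2 ≤ ‖x‖ ^ 2 := by
  simpa using ha.sum_inner_products_le x (s := Finset.univ)

theorem norm_pcaRank_le {a : Fin k → E d} (ha : Orthonormal ℝ a) (x : E d) :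
    ‖pcaRank a x‖ ≤ ‖x‖ := by
  refine le_of_sq_le_sq ?_ (norm_nonneg _)
  have h : ∀ j, inner ℝ (a j) (pcaRank a x) = inner ℝ (a j) x := fun j =>
    ha.inner_right_fintype (fun i => inner ℝ (a i) x) j
  rw [← real_inner_self_eq_norm_sq, inner_pcaRank]
  simp_rw [h, ← sq]
  exact sum_sq_inner_le ha x

theorem overlap_eq_sum_inner_pcaRank {k' : ℕ} (a : Fin k → E d) (b : Fin k' → E d) :
    overlap a b = ∑ l, inner ℝ (pcaRank a (b l)) (b l) := by
  simp_rw [inner_pcaRank_self]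
  exact Finset.sum_comm

theorem overlap_self {a : Fin k → E d} (ha : Orthonormal ℝ a) : overlap a a = k := by
  simp [overlap, orthonormal_iff_ite.1 ha]

/-- The Hilbert–Schmidt inner product of two projections is `tr (P Q)`, by Parseval. -/
theorem sum_inner_pcaRank_pcaRank {k' : ℕ} (a : Fin k → E d) (b : Fin k' → E d) {ι : Type*}
    [Fintype ι] (e : OrthonormalBasis ι ℝ (E d)) :
    ∑ i, inner ℝ (pcaRank a (e i)) (pcaRank b (e i)) = overlap a b := by
  simp_rw [inner_pcaRank]
  rw [Finset.sum_comm]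
  refine Finset.sum_congr rfl fun j _ => ?_
  simp_rw [← inner_pcaRank_comm]
  calc _ = ∑ i, inner ℝ (a j) (e i) * inner ℝ (e i) (pcaRank b (a j)) := by
        simp_rw [real_inner_comm (e _)]
    _ = ∑ l, inner ℝ (a j) (b l) ^ 2 := by
        rw [e.sum_inner_mul_inner, ← inner_pcaRank_comm, inner_pcaRank_self]
        simp_rw [real_inner_comm (a j)]

/-- The distance of two projections of the same rank is bounded by their Hilbert–Schmidt
distance. -/
theorem norm_pcaRank_sub_sq_le {a b : Fin k → E d} (ha : Orthonormal ℝ a) (hb : Orthonormal ℝ b)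
    (x : E d) : ‖pcaRank a x - pcaRank b x‖ ^ 2 ≤ 2 * (k - overlap a b) * ‖x‖ ^ 2 := by
  set e := EuclideanSpace.basisFun (Fin d) ℝ
  rw [← e.sum_sq_inner_right (pcaRank a x - pcaRank b x)]
  have h : ∀ i, inner ℝ (e i) (pcaRank a x - pcaRank b x) ^ 2
      ≤ ‖pcaRank a (e i) - pcaRank b (e i)‖ ^ 2 * ‖x‖ ^ 2 := fun i => by
    rw [inner_sub_right, ← inner_pcaRank_comm, ← inner_pcaRank_comm, ← inner_sub_left, ← mul_pow]
    exact sq_le_sq.2 ((abs_real_inner_le_norm _ _).trans (le_abs_self _))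
  refine (Finset.sum_le_sum fun i _ => h i).trans_eq ?_
  rw [← Finset.sum_mul]
  congr 1
  simp_rw [norm_sub_sq_real, ← real_inner_self_eq_norm_sq]
  rw [Finset.sum_add_distrib, Finset.sum_sub_distrib, ← Finset.mul_sum,
    sum_inner_pcaRank_pcaRank, sum_inner_pcaRank_pcaRank, sum_inner_pcaRank_pcaRank,
    overlap_self ha, overlap_self hb]
  ring

theorem overlap_le {a b : Fin k → E d} (ha : Orthonormal ℝ a) (hb : Orthonormal ℝ b) :
    overlap a b ≤ k := by
  rw [overlap_eq_sum_inner_pcaRank]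
  calc _ ≤ ∑ l : Fin k, (1 : ℝ) := Finset.sum_le_sum fun l _ => by
        rw [inner_pcaRank_self]
        simpa [hb.1 l] using sum_sq_inner_le ha (b l)
    _ = k := by simp

end ProjectionDistance

/-! ### Ky Fan's principle with a gap -/

section KyFan

variable {d k : ℕ} {C : E d →ₗ[ℝ] E d} (hC : C.IsSymmetric)

theorem inner_apply_eq_sum_eigenvalues (y : E d) :
    inner ℝ y (C y) = ∑ i, hC.eigenvalues finrank_euclideanSpace_fin i
      * inner ℝ (hC.eigenvectorBasis finrank_euclideanSpace_fin i) y ^ 2 := by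
  set e := hC.eigenvectorBasis finrank_euclideanSpace_fin
  rw [← e.sum_inner_mul_inner y (C y)]
  refine Finset.sum_congr rfl fun i _ => ?_
  rw [← hC, hC.apply_eigenvectorBasis, inner_smul_left, real_inner_comm y]
  simp only [RCLike.ofReal_real_eq_id, id, conj_trivial]
  ring

/-- Ky Fan's maximum principle with a gap: if `b` is an orthonormal family of `k` vectors, then its
trace falls short of the sum of the `k` largest eigenvalues by at least the gap times the part of
the top eigenspace that `b` misses. -/
theorem eigengap_mul_le (hk : 1 ≤ k) (hkd : k < d) {b : Fin k → E d} (hb : Orthonormal ℝ b) :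
    (hC.eigenvalues finrank_euclideanSpace_fin ⟨k - 1, by omega⟩
        - hC.eigenvalues finrank_euclideanSpace_fin ⟨k, hkd⟩)
      * (k - overlap (fun i : Fin k => hC.eigenvectorBasis finrank_euclideanSpace_fin
          (Fin.castLE hkd.le i)) b)
      ≤ ∑ i : Fin k, hC.eigenvalues finrank_euclideanSpace_fin (Fin.castLE hkd.le i)
        - ∑ j, inner ℝ (b j) (C (b j)) := by
  set e := hC.eigenvectorBasis finrank_euclideanSpace_fin
  set v := hC.eigenvalues finrank_euclideanSpace_fin
  have hv : Antitone v := hC.eigenvalues_antitone _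
  set q : Fin d → ℝ := fun i => ∑ j, inner ℝ (e i) (b j) ^ 2 with hq
  have hq0 : ∀ i, 0 ≤ q i := fun i => by positivity
  have hq1 : ∀ i, q i ≤ 1 := fun i => by
    have := sum_sq_inner_le hb (e i)
    simp_rw [hq, real_inner_comm (b _) (e i)]
    simpa using this
  have hqk : ∑ i, q i = k := by
    rw [Finset.sum_comm]
    simp [e.sum_sq_inner_right, hb.1]
  have htr : ∑ j, inner ℝ (b j) (C (b j)) = ∑ i, v i * q i := by
    simp_rw [inner_apply_eq_sum_eigenvalues hC, hq, Finset.mul_sum]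
    exact Finset.sum_comm
  have hsplit : ∀ f : Fin d → ℝ,
      ∑ j : Fin k, f (Fin.castLE hkd.le j) = ∑ i : Fin d, if (i : ℕ) < k then f i else 0 := fun f => by
    rw [← Finset.sum_filter]
    refine Finset.sum_bij (fun j _ => Fin.castLE hkd.le j) (by simp)
      (fun i _ j _ h => Fin.castLE_injective _ h) (fun i hi => ?_) (fun _ _ => rfl)
    exact ⟨⟨i, (Finset.mem_filter.1 hi).2⟩, Finset.mem_univ _, rfl⟩
  have hov : (k : ℝ) - overlap (fun i : Fin k => e (Fin.castLE hkd.le i)) b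
      = ∑ i : Fin d, if (i : ℕ) < k then 1 - q i else 0 := by
    rw [← hsplit fun i => 1 - q i, Finset.sum_sub_distrib]
    simp [overlap, hq]
  have hcard : ∑ i : Fin d, (if (i : ℕ) < k then (1 : ℝ) else 0) = k := by
    rw [← hsplit fun _ => 1]; simp
  rw [htr, hov, hsplit, Finset.mul_sum]
  set m := v ⟨k, hkd⟩ with hm
  -- The indicator of `i < k` and the weights `q` both sum to `k`, so `m = λ_{k+1}` may be
  -- subtracted from every eigenvalue. Then terms with `i ≥ k` are nonnegative, and the others are
  -- at least the gap times `1 - q i`.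
  have hrhs : ∑ i : Fin d, (if (i : ℕ) < k then v i else 0) - ∑ i, v i * q i
      = ∑ i, (v i - m) * ((if (i : ℕ) < k then 1 else 0) - q i) := by
    have : ∀ i : Fin d, (v i - m) * ((if (i : ℕ) < k then 1 else 0) - q i)
        = (if (i : ℕ) < k then v i else 0) - v i * q i
          - m * (if (i : ℕ) < k then (1 : ℝ) else 0) + m * q i := fun i => by
      split_ifs <;> ring
    simp_rw [this]
    rw [Finset.sum_add_distrib, Finset.sum_sub_distrib, Finset.sum_sub_distrib, ← Finset.mul_sum,
      ← Finset.mul_sum, hcard, hqk]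
    ring
  rw [hrhs]
  refine Finset.sum_le_sum fun i _ => ?_
  split_ifs with hi
  · have : v ⟨k - 1, by omega⟩ ≤ v i := hv (Fin.mk_le_mk.2 (by omega) : i ≤ ⟨k - 1, _⟩)
    exact mul_le_mul_of_nonneg_right (by linarith) (by linarith [hq1 i])
  · have : v i ≤ m := hv (Fin.mk_le_mk.2 (by omega) : (⟨k, hkd⟩ : Fin d) ≤ i)
    nlinarith [hq0 i]

end KyFan

/-! ### Stability of the top eigenspace -/

section EigengapStability

variable {n d k : ℕ}

theorem eigengap_nonneg (hk : 1 ≤ k) (hkd : k < d) (S : Dataset n d) :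
    0 ≤ eigengap k hk hkd S :=
  sub_nonneg.2 ((sampleCov_isSymmetric S).eigenvalues_antitone _ (Fin.mk_le_mk.2 (by omega)))

theorem sum_eigval_eq {hkd : k < d} {S : Dataset n d} {a : Fin k → E d}
    (ha : IsTopEigenvectors hkd S a) :
    ∑ i, eigval S (Fin.castLE hkd.le i) = ∑ j, inner ℝ (a j) (sampleCov S (a j)) := by
  refine Finset.sum_congr rfl fun i _ => ?_
  rw [ha.2 i, inner_smul_right, real_inner_self_eq_norm_sq, ha.1.1 i]
  simp

theorem sum_inner_sampleCov_le (hk : 1 ≤ k) {hkd : k < d} {S : Dataset n d} {a b : Fin k → E d}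
    (ha : IsTopEigenvectors hkd S a) (hb : Orthonormal ℝ b) :
    ∑ j, inner ℝ (b j) (sampleCov S (b j)) ≤ ∑ j, inner ℝ (a j) (sampleCov S (a j)) := by
  rw [← sum_eigval_eq ha, ← sub_nonneg]
  refine le_trans (mul_nonneg (eigengap_nonneg hk hkd S) (sub_nonneg.2 (overlap_le ?_ hb)))
    (eigengap_mul_le (sampleCov_isSymmetric S) hk hkd hb)
  exact (OrthonormalBasis.orthonormal _).comp _ (Fin.castLE_injective _)

/-- A positive gap makes the top eigenspace unique: Ky Fan applied to `a` itself forces the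
projections of `a` and of the eigenbasis `e` to agree, so the choice of eigenvectors is immaterial.
-/
theorem eigengap_mul_overlap_le (hk : 1 ≤ k) {hkd : k < d} {S : Dataset n d} {a b : Fin k → E d}
    (hgap : 0 < eigengap k hk hkd S) (ha : IsTopEigenvectors hkd S a) (hb : Orthonormal ℝ b) :
    eigengap k hk hkd S * (k - overlap a b) ≤
      ∑ j, inner ℝ (a j) (sampleCov S (a j)) - ∑ j, inner ℝ (b j) (sampleCov S (b j)) := by
  set e : Fin k → E d := fun i => (sampleCov_isSymmetric S).eigenvectorBasis
    finrank_euclideanSpace_fin (Fin.castLE hkd.le i) with he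
  have heo : Orthonormal ℝ e :=
    (OrthonormalBasis.orthonormal _).comp _ (Fin.castLE_injective _)
  have h : eigengap k hk hkd S * (k - overlap e a) ≤ _ :=
    eigengap_mul_le (sampleCov_isSymmetric S) hk hkd ha.1
  have h0 : (k : ℝ) - overlap e a ≤ 0 := by
    refine nonpos_of_mul_nonpos_right (h.trans_eq ?_) hgap
    exact sub_eq_zero.2 (sum_eigval_eq ha)
  have hea : ∀ x, pcaRank e x = pcaRank a x := fun x => by
    have := norm_pcaRank_sub_sq_le heo ha.1 x
    have h2 : ‖pcaRank e x - pcaRank a x‖ ^ 2 ≤ 0 := by nlinarith [sq_nonneg ‖x‖]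
    have h3 := pow_eq_zero_iff two_ne_zero |>.1 (le_antisymm h2 (sq_nonneg _))
    exact sub_eq_zero.1 (norm_eq_zero.1 h3)
  have hov : overlap a b = overlap e b := by
    simp_rw [overlap_eq_sum_inner_pcaRank, hea]
  rw [hov, ← sum_eigval_eq ha]
  exact eigengap_mul_le (sampleCov_isSymmetric S) hk hkd hb

theorem inner_sampleCov (S : Dataset n d) (hn : 2 ≤ n) (y : E d) :
    inner ℝ y (sampleCov S y) = (1 / ((n : ℝ) - 1)) *
      (∑ i, inner ℝ (S i : E d) y ^ 2 - (∑ i, inner ℝ (S i : E d) y) ^ 2 / n) := by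
  have hn' : (n : ℝ) ≠ 0 := by positivity
  simp only [sampleCov, LinearMap.smul_apply, LinearMap.sum_apply, ContinuousLinearMap.coe_coe,
    InnerProductSpace.rankOne_apply, inner_smul_right, inner_sum]
  congr 1
  set t := ∑ i, inner ℝ (S i : E d) y with ht
  have hm : inner ℝ (sampleMean S) y = t / n := by
    rw [sampleMean, inner_smul_left, sum_inner, ← ht]
    simp [div_eq_inv_mul]
  have h : ∀ i, inner ℝ ((S i : E d) - sampleMean S) y * inner ℝ y ((S i : E d) - sampleMean S)
      = inner ℝ (S i : E d) y ^ 2 - 2 * (t / n) * inner ℝ (S i : E d) y + (t / n) ^ 2 :=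
    fun i => by
      rw [real_inner_comm (_ - _) y, ← sq, inner_sub_left, hm]
      ring
  simp_rw [h]
  rw [Finset.sum_add_distrib, Finset.sum_sub_distrib, ← Finset.mul_sum, ← ht]
  simp only [Finset.sum_const, Finset.card_univ, Fintype.card_fin, nsmul_eq_mul]
  field_simp
  ring

/-- Replacing one point changes the covariance matrix by `(u uᵀ - v vᵀ) / n`, where `u` and `v` are
the differences of the old and the new point to the mean of the others. -/
theorem exists_inner_sampleCov_sub (hn : 2 ≤ n) {S S' : Dataset n d} {j : Fin n}
    (h : ∀ i, i ≠ j → S i = S' i) : ∃ u v : E d, ‖u‖ ≤ 2 ∧ ‖v‖ ≤ 2 ∧ ∀ y,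
      inner ℝ y (sampleCov S y) - inner ℝ y (sampleCov S' y)
        = (1 / (n : ℝ)) * (inner ℝ u y ^ 2 - inner ℝ v y ^ 2) := by
  have hn2 : (2 : ℝ) ≤ n := by exact_mod_cast hn
  have hn1 : (0 : ℝ) < n - 1 := by linarith
  set m : E d := (1 / ((n : ℝ) - 1)) • ∑ i ∈ Finset.univ.erase j, (S i : E d) with hm
  have hball : ∀ z : Instance d, ‖(z : E d)‖ ≤ 1 := fun z =>
    mem_closedBall_zero_iff.1 z.2
  have hm1 : ‖m‖ ≤ 1 := by
    rw [hm, norm_smul, Real.norm_of_nonneg (by positivity), one_div, inv_mul_le_one₀ hn1]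
    refine (norm_sum_le_of_le _ fun i _ => hball (S i)).trans_eq ?_
    rw [Finset.sum_const, Finset.card_erase_of_mem (Finset.mem_univ _), Finset.card_univ,
      Fintype.card_fin, nsmul_eq_mul, mul_one, Nat.cast_pred (by omega)]
  refine ⟨S j - m, S' j - m, ?_, ?_, fun y => ?_⟩
  · exact (norm_sub_le _ _).trans (by linarith [hball (S j)])
  · exact (norm_sub_le _ _).trans (by linarith [hball (S' j)])
  have hs : ∀ f : Instance d → ℝ, ∑ i, f (S' i)
      = f (S' j) + ∑ i ∈ Finset.univ.erase j, f (S i) := fun f => by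
    rw [← Finset.add_sum_erase _ _ (Finset.mem_univ j)]
    congr 1
    exact Finset.sum_congr rfl fun i hi => by rw [h i (Finset.ne_of_mem_erase hi)]
  rw [inner_sampleCov _ hn, inner_sampleCov _ hn, hs fun z => inner ℝ (z : E d) y ^ 2,
    hs fun z => inner ℝ (z : E d) y,
    ← Finset.add_sum_erase _ (fun i => inner ℝ (S i : E d) y ^ 2) (Finset.mem_univ j),
    ← Finset.add_sum_erase _ (fun i => inner ℝ (S i : E d) y) (Finset.mem_univ j),
    inner_sub_left, inner_sub_left, hm, inner_smul_left, sum_inner]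
  simp only [conj_trivial]
  field_simp
  ring

/-- A Davis–Kahan bound for replacing one point of the dataset; only one of the two datasets has to
have an eigen-gap. -/
theorem norm_pcaRank_sub_le (hn : 2 ≤ n) (hk : 1 ≤ k) {hkd : k < d} {S S' : Dataset n d} {j : Fin n}
    (h : ∀ i, i ≠ j → S i = S' i) {β : ℝ} (hβ : 0 < β) (hgap : β ≤ eigengap k hk hkd S)
    {a b : Fin k → E d} (ha : IsTopEigenvectors hkd S a) (hb : IsTopEigenvectors hkd S' b)
    (x : E d) : ‖pcaRank a x - pcaRank b x‖ ≤ 16 / (n * β) * ‖x‖ := by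
  obtain ⟨u, v, hu, hv, huv⟩ := exists_inner_sampleCov_sub hn h
  have hn0 : (0 : ℝ) < n := by positivity
  have hov := sub_nonneg.2 (overlap_le ha.1 hb.1)
  -- `f` is the Hilbert–Schmidt distance of the two projections. It bounds their operator distance,
  -- and its square also appears in the Ky Fan deficit.
  set f := √(2 * (k - overlap a b)) with hf
  have hf2 : f ^ 2 = 2 * (k - overlap a b) := Real.sq_sqrt (by linarith)
  have hf0 : 0 ≤ f := Real.sqrt_nonneg _
  have hF : ∀ x, ‖pcaRank a x - pcaRank b x‖ ≤ f * ‖x‖ := fun x => by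
    refine le_of_sq_le_sq ?_ (by positivity)
    rw [mul_pow, hf2]
    exact norm_pcaRank_sub_sq_le ha.1 hb.1 x
  have h1 := eigengap_mul_overlap_le hk (hβ.trans_le hgap) ha hb.1
  have h2 := sum_inner_sampleCov_le hk hb ha.1
  have htr : ∀ c : Fin k → E d, ∑ j, inner ℝ (c j) (sampleCov S (c j))
      - ∑ j, inner ℝ (c j) (sampleCov S' (c j))
      = (1 / (n : ℝ)) * (inner ℝ (pcaRank c u) u - inner ℝ (pcaRank c v) v) := fun c => by
    rw [← Finset.sum_sub_distrib, inner_pcaRank_self, inner_pcaRank_self]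
    simp_rw [huv, ← Finset.mul_sum, Finset.sum_sub_distrib, real_inner_comm (c _)]
  have hin : ∀ w : E d, ‖w‖ ≤ 2 →
      |inner ℝ (pcaRank a w) w - inner ℝ (pcaRank b w) w| ≤ 4 * f := fun w hw => by
    rw [← inner_sub_left]
    calc _ ≤ ‖pcaRank a w - pcaRank b w‖ * ‖w‖ := abs_real_inner_le_norm _ _
      _ ≤ f * ‖w‖ * ‖w‖ := by gcongr; exact hF w
      _ ≤ f * 2 * 2 := by gcongr
      _ = 4 * f := by ring
  have h3 : β * (f ^ 2 / 2) ≤ (1 / n) * (8 * f) := by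
    calc β * (f ^ 2 / 2) = β * (k - overlap a b) := by rw [hf2]; ring
      _ ≤ eigengap k hk hkd S * (k - overlap a b) := by gcongr
      _ ≤ (1 / n) * ((inner ℝ (pcaRank a u) u - inner ℝ (pcaRank b u) u)
          - (inner ℝ (pcaRank a v) v - inner ℝ (pcaRank b v) v)) := by
        linarith [htr a, htr b]
      _ ≤ _ := by
        have := abs_le.1 (hin u hu)
        have := abs_le.1 (hin v hv)
        gcongr
        linarith
  have h4 : f ≤ 16 / (n * β) := by
    rw [le_div_iff₀ (by positivity)]
    rcases hf0.eq_or_lt with h0 | h0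
    · rw [← h0]; norm_num
    · have : β * (f ^ 2 / 2) * (2 * n) ≤ (1 / n) * (8 * f) * (2 * n) := by gcongr
      have e : (1 / n) * (8 * f) * (2 * n) = 16 * f := by field_simp; ring
      rw [e] at this
      refine le_of_mul_le_mul_right (?_ : f * (n * β) * f ≤ 16 * f) h0
      linarith
  exact (hF x).trans (by gcongr)

end EigengapStability

/-! ### Sensitivity of the average gradient -/

section GradientSensitivity

/-- At a non-interior point the Lipschitz bound on `Θ` does not control every direction, so the
bound is carried there as a limit from the interior. -/
theorem norm_gradient_le_of_lipschitz {p : ℕ} {f : E p → ℝ} {Θ : Set (E p)} {L : ℝ} (hL : 0 ≤ L)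
    (hLip : ∀ θ ∈ Θ, ∀ θ' ∈ Θ, |f θ - f θ'| ≤ L * ‖θ - θ'‖)
    (hbd : ∀ θ ∈ Θ \ interior Θ, θ ∈ closure (interior Θ) ∧
      ContinuousWithinAt (gradient f) (interior Θ) θ) {θ : E p} (hθ : θ ∈ Θ) :
    ‖gradient f θ‖ ≤ L := by
  have hint : ∀ θ ∈ interior Θ, ‖gradient f θ‖ ≤ L := fun θ hθ => by
    rw [gradient, LinearIsometryEquiv.norm_map]
    refine norm_fderiv_le_of_lip' ℝ hL ?_
    filter_upwards [mem_interior_iff_mem_nhds.1 hθ] with x hx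
    exact hLip x hx θ (interior_subset hθ)
  by_cases h : θ ∈ interior Θ
  · exact hint θ h
  · obtain ⟨hc, hcont⟩ := hbd θ ⟨hθ, h⟩
    have := mem_closure_iff_nhdsWithin_neBot.1 hc
    exact le_of_tendsto hcont.norm (eventually_mem_nhdsWithin.mono hint)

/-- The replaced point contributes `2L/n`; all the others may move slightly because the projection
changed, and contribute at most `c` on average. -/
theorem norm_avgGrad_sub_le {n d p : ℕ} (hn : 0 < n) {ℓ : E p → E d → ℝ} {w : E p} {L c : ℝ}
    {D D' : Fin n → E d} (j : Fin n) (hc : 0 ≤ c)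
    (hL : ∀ i, ‖gradient (fun θ => ℓ θ (D i)) w‖ ≤ L)
    (hL' : ∀ i, ‖gradient (fun θ => ℓ θ (D' i)) w‖ ≤ L)
    (h : ∀ i, i ≠ j →
      ‖gradient (fun θ => ℓ θ (D i)) w - gradient (fun θ => ℓ θ (D' i)) w‖ ≤ c) :
    ‖avgGrad ℓ D w - avgGrad ℓ D' w‖ ≤ 2 * L / n + c := by
  have hn0 : (0 : ℝ) < n := by exact_mod_cast hn
  rw [avgGrad, avgGrad, ← smul_sub, ← Finset.sum_sub_distrib, norm_smul,
    Real.norm_of_nonneg (by positivity), ← Finset.add_sum_erase _ _ (Finset.mem_univ j)]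
  have h1 : ‖∑ i ∈ Finset.univ.erase j,
      (gradient (fun θ => ℓ θ (D i)) w - gradient (fun θ => ℓ θ (D' i)) w)‖ ≤ n * c := by
    refine (norm_sum_le_of_le _ fun i hi => h i (Finset.ne_of_mem_erase hi)).trans ?_
    rw [Finset.sum_const, nsmul_eq_mul]
    gcongr
    exact (Finset.card_le_univ _).trans_eq (Fintype.card_fin n)
  have h2 := norm_sub_le (gradient (fun θ => ℓ θ (D j)) w) (gradient (fun θ => ℓ θ (D' j)) w)
  calc _ ≤ (1 / (n : ℝ)) * (2 * L + n * c) := by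
        gcongr
        exact (norm_add_le _ _).trans (by linarith [hL j, hL' j])
    _ = _ := by field_simp

end GradientSensitivity

/-! ### The Laplace mechanism -/

section Laplace

variable {b : ℝ}

theorem laplace_Ioi (hb : 0 < b) {t : ℝ} (ht : 0 ≤ t) :
    laplace b (Set.Ioi t) = ENNReal.ofReal (Real.exp (-t / b) / 2) := by
  have hi : IntegrableOn (fun z => Real.exp (-b⁻¹ * z)) (Set.Ioi t) :=
    integrableOn_exp_mul_Ioi (by simpa using hb) t
  rw [laplace, withDensity_apply _ measurableSet_Ioi]
  have h : ∀ z ∈ Set.Ioi t, ENNReal.ofReal (1 / (2 * b) * Real.exp (-|z| / b))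
      = ENNReal.ofReal (1 / (2 * b) * Real.exp (-b⁻¹ * z)) := fun z hz => by
    rw [abs_of_nonneg (ht.trans (le_of_lt hz))]
    congr 3
    field_simp
  rw [setLIntegral_congr_fun measurableSet_Ioi h, ← ofReal_integral_eq_lintegral_ofReal
    (hi.const_mul _) (Filter.Eventually.of_forall fun z => by positivity), integral_const_mul,
    integral_exp_mul_Ioi (by simpa using hb)]
  congr 1
  have : -b⁻¹ * t = -t / b := by field_simp
  rw [this]
  field_simp

theorem isProbabilityMeasure_laplace (hb : 0 < b) : IsProbabilityMeasure (laplace b) := by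
  have h1 : ∫ z : ℝ, 1 / (2 * b) * Real.exp (-|z| / b) = 1 := by
    rw [integral_comp_abs (f := fun z => 1 / (2 * b) * Real.exp (-z / b)), integral_const_mul]
    have : ∀ z, -z / b = -b⁻¹ * z := fun z => by field_simp
    simp_rw [this]
    rw [integral_exp_mul_Ioi (by simpa using hb)]
    simp
    field_simp
  refine ⟨?_⟩
  rw [laplace, withDensity_apply _ MeasurableSet.univ, setLIntegral_univ,
    ← ofReal_integral_eq_lintegral_ofReal (integrable_of_integral_eq_one h1)
    (Filter.Eventually.of_forall fun z => by positivity), h1, ENNReal.ofReal_one]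

theorem laplace_preimage_add_le (hb : 0 < b) (c : ℝ) {s : Set ℝ} (hs : MeasurableSet s) :
    laplace b ((fun z => z + c) ⁻¹' s) ≤ ENNReal.ofReal (Real.exp (|c| / b)) * laplace b s := by
  have hm : Measurable fun z : ℝ => z + c := by fun_prop
  rw [laplace, withDensity_apply _ (hm hs), withDensity_apply _ hs,
    ← lintegral_const_mul _ (by fun_prop), ← lintegral_indicator (hm hs), ← lintegral_indicator hs,
    ← lintegral_add_right_eq_self (μ := volume) (s.indicator _) c]
  refine lintegral_mono fun z => ?_
  by_cases hz : z + c ∈ s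
  · rw [Set.indicator_of_mem (show z ∈ (fun z => z + c) ⁻¹' s from hz), Set.indicator_of_mem hz,
      ← ENNReal.ofReal_mul (Real.exp_pos _).le]
    refine ENNReal.ofReal_le_ofReal ?_
    rw [mul_left_comm, ← Real.exp_add, ← add_div]
    gcongr
    linarith [abs_add_le z c]
  · rw [Set.indicator_of_notMem (by exact hz)]
    exact zero_le

end Laplace

/-! ### Propose-test-release -/

section ProposeTestRelease

variable {n d : ℕ}

theorem exists_forall_ne_eq_of_hamming_eq_one {X : Type*} {S S' : Fin n → X}
    (h : hamming S S' = 1) : ∃ j, ∀ i, i ≠ j → S i = S' i := by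
  classical
  rw [hamming, hammingDist] at h
  obtain ⟨j, hj⟩ := Finset.card_eq_one.1 h
  refine ⟨j, fun i hij => by_contra fun hne => hij ?_⟩
  rw [← Finset.mem_singleton, ← hj]
  simpa using hne

theorem hamming_comm {X : Type*} (S S' : Fin n → X) : hamming S S' = hamming S' S :=
  open scoped Classical in hammingDist_comm _ _

theorem hamming_self {X : Type*} (S : Fin n → X) : hamming S S = 0 :=
  open scoped Classical in hammingDist_self _

theorem hamming_triangle {X : Type*} (S S' S'' : Fin n → X) :
    hamming S S'' ≤ hamming S S' + hamming S' S'' :=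
  open scoped Classical in hammingDist_triangle _ _ _

theorem gapDist_le_add_hamming (k : ℕ) (hk : 1 ≤ k) (hkd : k < d) (β : ℝ) (S S' : Dataset n d) :
    gapDist k hk hkd β S ≤ hamming S S' + gapDist k hk hkd β S' := by
  by_cases h : ∃ R : Dataset n d, eigengap k hk hkd R < β
  · obtain ⟨R, hR⟩ := h
    obtain ⟨R', hR', h'⟩ := Nat.sInf_mem
      (⟨_, R, hR, rfl⟩ :
        {m | ∃ R : Dataset n d, eigengap k hk hkd R < β ∧ hamming S' R = m}.Nonempty)
    refine (Nat.sInf_le ⟨R', hR', rfl⟩ : gapDist k hk hkd β S ≤ hamming S R').trans ?_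
    rw [gapDist, ← h']
    exact hamming_triangle _ _ _
  -- Here the infimum is over the empty set and takes the default value `0`.
  · have : gapDist k hk hkd β S = 0 := by
      rw [gapDist, Nat.sInf_eq_zero]
      right
      ext m
      simp only [Set.mem_ofPred_eq, Set.mem_empty_iff_false, iff_false]
      rintro ⟨R, hR, -⟩
      exact h ⟨R, hR⟩
    omega

theorem le_eigengap_of_gapDist_ne_zero {k : ℕ} {hk : 1 ≤ k} {hkd : k < d} {β : ℝ}
    {S : Dataset n d} (h : gapDist k hk hkd β S ≠ 0) : β ≤ eigengap k hk hkd S := by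
  by_contra! hlt
  exact h (Nat.sInf_eq_zero.2 (Or.inl ⟨S, hlt, hamming_self S⟩))

theorem bind_ite_const_apply {X Y : Type*} [MeasurableSpace X] [MeasurableSpace Y] (P : Measure X)
    (p : X → Prop) [DecidablePred p] (hp : MeasurableSet {x | p x}) (μ₁ μ₂ : Measure Y) {O : Set Y}
    (hO : MeasurableSet O) :
    (P.bind fun x => if p x then μ₁ else μ₂) O = P {x | p x} * μ₁ O + P {x | ¬p x} * μ₂ O := by
  rw [Measure.bind_apply hO (Measurable.ite hp measurable_const measurable_const).aemeasurable,
    ← lintegral_add_compl _ hp]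
  congr 1
  · rw [setLIntegral_congr_fun hp (g := fun _ => μ₁ O) fun x hx => by
      simp only [Set.mem_ofPred_eq] at hx; simp only [if_pos hx]]
    rw [setLIntegral_const, mul_comm]
  · rw [setLIntegral_congr_fun hp.compl (g := fun _ => μ₂ O) fun x hx => by
      simp only [Set.mem_compl_iff, Set.mem_ofPred_eq] at hx; simp only [if_neg hx]]
    rw [setLIntegral_const, mul_comm]
    rfl

variable {p k : ℕ} {hk : 1 ≤ k} {hkd : k < d} {A : Dataset n d → Fin k → E d}
    {ℓ : E p → E d → ℝ} {L : ℝ} {H : Set (E p)} {ν : Measure (E p)} {η : ℝ} {T : ℕ}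
    {ε δ β : ℝ}

theorem measurableSet_threshold (q τ : ℝ) : MeasurableSet {z : ℝ | q + z ≤ τ} :=
  measurableSet_le (by fun_prop) measurable_const

theorem ptr_apply (S : Dataset n d) {O : Set (E p ⊕ Unit)} (hO : MeasurableSet O) :
    ptr k hk hkd A ℓ L H ν η T ε δ β S O
      = laplace (1 / ε) {z | (gapDist k hk hkd β S : ℝ) + z ≤ Real.log (2 / δ) / ε}
          * Measure.dirac (Sum.inr ()) O
        + laplace (1 / ε) {z | ¬((gapDist k hk hkd β S : ℝ) + z ≤ Real.log (2 / δ) / ε)}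
          * dpGD ℓ H ν η (2 * L * √T / (ε * n)) T (fun i => pcaRank (A S) (S i))
            (Sum.inl ⁻¹' O) := by
  classical
  rw [ptr, bind_ite_const_apply _ _ (measurableSet_threshold _ _) _ _ hO,
    Measure.map_apply measurable_inl hO]

theorem isProbabilityMeasure_ptr (hε : 0 < ε) (hH : Measurable (metricProj H))
    [IsProbabilityMeasure ν] (S : Dataset n d) :
    IsProbabilityMeasure (ptr k hk hkd A ℓ L H ν η T ε δ β S) := by
  have := isProbabilityMeasure_laplace (one_div_pos.2 hε)
  have := isProbabilityMeasure_dpGD ℓ η (2 * L * √T / (ε * n)) (fun i => pcaRank (A S) (S i)) hH ν T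
  refine ⟨?_⟩
  rw [ptr_apply S MeasurableSet.univ, Set.preimage_univ, measure_univ, measure_univ, mul_one,
    mul_one, ← Set.compl_ofPred, measure_add_measure_compl (measurableSet_threshold _ _),
    measure_univ]

theorem laplace_threshold_le (hε : 0 < ε) {q q' : ℝ} (h : |q - q'| ≤ 1) (τ : ℝ) :
    laplace (1 / ε) {z | q + z ≤ τ}
        ≤ ENNReal.ofReal (Real.exp ε) * laplace (1 / ε) {z | q' + z ≤ τ} ∧
      laplace (1 / ε) {z | ¬(q + z ≤ τ)}
        ≤ ENNReal.ofReal (Real.exp ε) * laplace (1 / ε) {z | ¬(q' + z ≤ τ)} := by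
  have hle : ∀ s : Set ℝ, ENNReal.ofReal (Real.exp (|q - q'| / (1 / ε))) * laplace (1 / ε) s
      ≤ ENNReal.ofReal (Real.exp ε) * laplace (1 / ε) s := fun s => by
    gcongr
    rw [div_div_eq_mul_div, div_one]
    nlinarith
  have hs := measurableSet_threshold q' τ
  have he : {z : ℝ | q + z ≤ τ} = (fun z => z + (q - q')) ⁻¹' {z | q' + z ≤ τ} := by
    ext z
    change q + z ≤ τ ↔ q' + (z + (q - q')) ≤ τ
    rw [show q' + (z + (q - q')) = q + z by ring]
  rw [← Set.compl_ofPred, ← Set.compl_ofPred, he, ← Set.preimage_compl]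
  exact ⟨(laplace_preimage_add_le (one_div_pos.2 hε) _ hs).trans (hle _),
    (laplace_preimage_add_le (one_div_pos.2 hε) _ hs.compl).trans (hle _)⟩

/-- Privacy of propose-test-release: it suffices that DP-GD is private on neighbouring datasets of
which the first one has an eigen-gap. -/
theorem isDP_ptr (hε : 0 < ε) (hδ : 0 < δ) (hδ1 : δ ≤ 1) {ε' : ℝ} (hε' : 0 ≤ ε')
    (h : ∀ S S' : Dataset n d, hamming S S' = 1 → β ≤ eigengap k hk hkd S →
      ∀ O : Set (E p), MeasurableSet O →
        dpGD ℓ H ν η (2 * L * √T / (ε * n)) T (fun i => pcaRank (A S) (S i)) O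
          ≤ ENNReal.ofReal (Real.exp ε')
              * dpGD ℓ H ν η (2 * L * √T / (ε * n)) T (fun i => pcaRank (A S') (S' i)) O
            + ENNReal.ofReal δ)
    (hprob : ∀ D : Fin n → E d,
      IsProbabilityMeasure (dpGD ℓ H ν η (2 * L * √T / (ε * n)) T D)) :
    IsDP (ptr k hk hkd A ℓ L H ν η T ε δ β) (ε' + ε) δ := by
  intro S S' hSS' O hO
  have := isProbabilityMeasure_laplace (one_div_pos.2 hε)
  rw [ptr_apply S hO, ptr_apply S' hO]
  set τ := Real.log (2 / δ) / ε
  have hq : |(gapDist k hk hkd β S : ℝ) - gapDist k hk hkd β S'| ≤ 1 := by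
    have h1 := gapDist_le_add_hamming k hk hkd β S S'
    have h2 := gapDist_le_add_hamming k hk hkd β S' S
    rw [hamming_comm, hSS'] at h2
    rw [hSS'] at h1
    rw [abs_le]
    have h1' : (gapDist k hk hkd β S : ℝ) ≤ 1 + gapDist k hk hkd β S' := by exact_mod_cast h1
    have h2' : (gapDist k hk hkd β S' : ℝ) ≤ 1 + gapDist k hk hkd β S := by exact_mod_cast h2
    constructor <;> linarith
  obtain ⟨hbot, hrel⟩ := laplace_threshold_le hε hq τ
  have hE : 1 ≤ ENNReal.ofReal (Real.exp ε') := by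
    rw [ENNReal.one_le_ofReal]
    exact Real.one_le_exp hε'
  rw [Real.exp_add, ENNReal.ofReal_mul (Real.exp_pos _).le]
  set e := ENNReal.ofReal (Real.exp ε)
  set e' := ENNReal.ofReal (Real.exp ε')
  set x := Measure.dirac (Sum.inr () : E p ⊕ Unit) O
  set c' := laplace (1 / ε) {z | ¬((gapDist k hk hkd β S' : ℝ) + z ≤ τ)}
  set a' := laplace (1 / ε) {z | (gapDist k hk hkd β S' : ℝ) + z ≤ τ}
  have hax : laplace (1 / ε) {z | (gapDist k hk hkd β S : ℝ) + z ≤ τ} * x ≤ e' * e * (a' * x) := by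
    calc _ ≤ e * a' * x := by gcongr
      _ = 1 * (e * a' * x) := (one_mul _).symm
      _ ≤ e' * (e * a' * x) := by gcongr
      _ = _ := by ring
  rw [mul_add, add_assoc]
  refine add_le_add hax ?_
  -- At distance `0` a release requires `Z > τ`, which has probability `exp (-ε τ) / 2 = δ / 4`. At
  -- nonzero distance `S` has the gap, and the `δ` of DP-GD is only weighted by a probability.
  by_cases h0 : gapDist k hk hkd β S = 0
  · have := hprob fun i => pcaRank (A S) (S i)
    refine le_trans ?_ le_add_self
    have hset : {z : ℝ | ¬((gapDist k hk hkd β S : ℝ) + z ≤ τ)} = Set.Ioi τ := by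
      ext z
      simp [h0]
    have hτ : 0 ≤ τ := div_nonneg (Real.log_nonneg (by rw [le_div_iff₀ hδ]; linarith)) hε.le
    rw [hset, laplace_Ioi (one_div_pos.2 hε) hτ]
    refine (mul_le_of_le_one_right' prob_le_one).trans (ENNReal.ofReal_le_ofReal ?_)
    have : -τ / (1 / ε) = -Real.log (2 / δ) := by
      simp only [τ]
      field_simp
    rw [this, Real.exp_neg, Real.exp_log (by positivity), inv_div]
    linarith
  · calc _ ≤ laplace (1 / ε) {z | ¬((gapDist k hk hkd β S : ℝ) + z ≤ τ)} *
          (e' * dpGD ℓ H ν η (2 * L * √T / (ε * n)) T (fun i => pcaRank (A S') (S' i))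
            (Sum.inl ⁻¹' O) + ENNReal.ofReal δ) := by
          gcongr
          exact h S S' hSS' (le_eigengap_of_gapDist_ne_zero h0) _ (measurable_inl hO)
      _ ≤ e * c' * (e' * dpGD ℓ H ν η (2 * L * √T / (ε * n)) T
            (fun i => pcaRank (A S') (S' i)) (Sum.inl ⁻¹' O)) + 1 * ENNReal.ofReal δ := by
          rw [mul_add]
          gcongr
          exact prob_le_one
      _ = _ := by ring

end ProposeTestRelease

/-! ### DP-GD on projected data, and the constants -/

theorem dpGD_pcaRank_approx_dp {n d p k : ℕ} (hn : 2 ≤ n) (hk : 1 ≤ k) {hkd : k < d}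
    {A : Dataset n d → Fin k → E d} (hA : ∀ S, IsTopEigenvectors hkd S (A S))
    {H : Set (E p)} (hHc : IsClosed H) (hHconv : Convex ℝ H) (hHne : H.Nonempty)
    (ν : Measure (E p)) [IsProbabilityMeasure ν] (hν : ∀ᵐ w ∂ν, w ∈ H) (η : ℝ) {T : ℕ} (hT : 1 ≤ T)
    {ℓ : E p → E d → ℝ} {L μ : ℝ} (hL : 0 < L)
    (hgrad : ∀ w ∈ H, ∀ x ∈ Metric.closedBall (0 : E d) 1, ‖gradient (fun θ => ℓ θ x) w‖ ≤ L)
    (hsmooth : ∀ w ∈ H, ∀ x ∈ Metric.closedBall (0 : E d) 1, ∀ x' ∈ Metric.closedBall (0 : E d) 1,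
      ‖gradient (fun θ => ℓ θ x) w - gradient (fun θ => ℓ θ x') w‖ ≤ μ * ‖x - x'‖)
    {ε δ β ρ : ℝ} (hε : 0 < ε) (hβ : 0 < β) (hδ : 0 < δ)
    (hρ : ε ^ 2 * (1 + 8 * μ / (L * β)) ^ 2 / 2 ≤ ρ) (hρ0 : 0 < ρ) (hρδ : ρ ≤ Real.log (1 / δ))
    {S S' : Dataset n d} (hSS' : hamming S S' = 1) (hgap : β ≤ eigengap k hk hkd S)
    {O : Set (E p)} (hO : MeasurableSet O) :
    dpGD ℓ H ν η (2 * L * √T / (ε * n)) T (fun i => pcaRank (A S) (S i)) O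
      ≤ ENNReal.ofReal (Real.exp (3 * √(ρ * Real.log (1 / δ))))
          * dpGD ℓ H ν η (2 * L * √T / (ε * n)) T (fun i => pcaRank (A S') (S' i)) O
        + ENNReal.ofReal δ := by
  obtain ⟨j, hj⟩ := exists_forall_ne_eq_of_hamming_eq_one hSS'
  have hn0 : (0 : ℝ) < n := by positivity
  have hT0 : (0 : ℝ) < T := by exact_mod_cast hT
  have hball : ∀ z : Instance d, ‖(z : E d)‖ ≤ 1 := fun z => mem_closedBall_zero_iff.1 z.2
  have hD : ∀ (S : Dataset n d) i, pcaRank (A S) (S i) ∈ Metric.closedBall (0 : E d) 1 :=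
    fun S i => mem_closedBall_zero_iff.2 ((norm_pcaRank_le (hA S).1 _).trans (hball _))
  -- The smoothness bound between a unit vector and `0` forces this sign.
  have hμ : 0 ≤ μ := by
    obtain ⟨w, hw⟩ := hHne
    have hone : ‖EuclideanSpace.single (⟨k, hkd⟩ : Fin d) (1 : ℝ)‖ = 1 := by simp
    have h := (norm_nonneg _).trans (hsmooth w hw (EuclideanSpace.single ⟨k, hkd⟩ 1)
      (mem_closedBall_zero_iff.2 hone.le) 0 (by simp))
    rwa [sub_zero, hone, mul_one] at h
  refine dpGD_approx_dp ℓ hHc hHne (measurable_metricProj hHc hHconv hHne) ν hν η (by positivity) T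
    _ _ (Δ := 2 * L / n + μ * (16 / (n * β))) (fun w hw => ?_) (le_trans (le_of_eq ?_) hρ)
    hρ0 hδ hρδ hO
  · refine norm_avgGrad_sub_le (by omega) j (by positivity) (fun i => hgrad w hw _ (hD S i))
      (fun i => hgrad w hw _ (hD S' i)) fun i hi => ?_
    refine (hsmooth w hw _ (hD S i) _ (hD S' i)).trans ?_
    gcongr
    rw [← hj i hi]
    refine (norm_pcaRank_sub_le hn hk hj hβ hgap (hA S) (hA S') _).trans ?_
    exact mul_le_of_le_one_right (by positivity) (hball _)
  · have hs : √(T : ℝ) ^ 2 = T := Real.sq_sqrt hT0.le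
    have h1 : (2 * L / n + μ * (16 / (n * β))) / (2 * L * √T / (ε * n))
        = ε * (1 + 8 * μ / (L * β)) / √T := by
      have : √(T : ℝ) ≠ 0 := by positivity
      field_simp
      ring
    rw [h1, div_pow, hs]
    field_simp

end PTRPCA

end

open PTRPCA
theorem mainTheorem4 {n d p : ℕ} (hn : 101 ≤ n)
    -- the rank `k` and a choice of the first `k` eigenvectors for every dataset
    (k : ℕ) (hk : 1 ≤ k) (hkd : k < d)
    (A : Dataset n d → Fin k → E d) (hA : ∀ S, IsTopEigenvectors hkd S (A S))
    -- the parameter space of DP-GD, its data-independent initialization, step size and length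
    (H : Set (E p)) (hHc : IsClosed H) (hHconv : Convex ℝ H) (hHne : H.Nonempty)
    (ν : Measure (E p)) [IsProbabilityMeasure ν] (hν : ∀ᵐ w ∂ν, w ∈ H)
    (η : ℝ) (T : ℕ) (hT : 1 ≤ T)
    -- the loss: differentiable and `L`-Lipschitz in the parameter, with a gradient that is
    -- `μ`-Lipschitz in the data point
    (ℓ : E p → E d → ℝ) (Θ : Set (E p)) (hHΘ : H ⊆ Θ)
    (hdiff : ∀ θ ∈ Θ, ∀ x ∈ Metric.closedBall (0 : E d) 1, DifferentiableAt ℝ (fun w => ℓ w x) θ)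
    -- no condition if `Θ` is open
    (hbd : ∀ θ ∈ Θ \ interior Θ, θ ∈ closure (interior Θ) ∧
      ∀ x ∈ Metric.closedBall (0 : E d) 1,
        ContinuousWithinAt (gradient fun w => ℓ w x) (interior Θ) θ)
    (L μ : ℝ) (hL : 0 < L)
    (hLip : ∀ x ∈ Metric.closedBall (0 : E d) 1, ∀ θ ∈ Θ, ∀ θ' ∈ Θ,
      |ℓ θ x - ℓ θ' x| ≤ L * ‖θ - θ'‖)
    (hsmooth : ∀ θ ∈ Θ, ∀ x ∈ Metric.closedBall (0 : E d) 1, ∀ x' ∈ Metric.closedBall (0 : E d) 1,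
      ‖gradient (fun w => ℓ w x) θ - gradient (fun w => ℓ w x') θ‖ ≤ μ * ‖x - x'‖)
    (ε δ β : ℝ) (hε : 0 < ε) (hβ : 0 < β) (hδ : 0 < δ)
    (hδ' : δ ≤ Real.exp (-(1.05 * ε ^ 2 * (1 + 12.2 ^ 2 * μ ^ 2 / (L ^ 2 * β ^ 2))))) :
    (∀ S : Dataset n d, IsProbabilityMeasure (ptr k hk hkd A ℓ L H ν η T ε δ β S)) ∧
    IsDP (ptr k hk hkd A ℓ L H ν η T ε δ β)
      (3 * ε * √(1.05 * (1 + 12.2 ^ 2 * μ ^ 2 / (L ^ 2 * β ^ 2)) * Real.log (1 / δ)) + ε) δ := by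
  set X := 1.05 * (1 + 12.2 ^ 2 * μ ^ 2 / (L ^ 2 * β ^ 2)) with hX
  have hX0 : 0 < X := by positivity
  have hlog : ε ^ 2 * X ≤ Real.log (1 / δ) := by
    rw [one_div, Real.log_inv, le_neg]
    refine (Real.log_le_iff_le_exp hδ).2 (hδ'.trans_eq ?_)
    rw [hX]
    ring_nf
  have hδ1 : δ ≤ 1 := hδ'.trans (Real.exp_le_one_iff.2 (neg_nonpos.2 (by positivity)))
  have hm := measurable_metricProj hHc hHconv hHne
  refine ⟨isProbabilityMeasure_ptr hε hm, isDP_ptr hε hδ hδ1 (by positivity)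
    (fun S S' hSS' hgap O hO => ?_) fun D => isProbabilityMeasure_dpGD ℓ η _ D hm ν T⟩
  have hε' : 3 * ε * √(X * Real.log (1 / δ)) = 3 * √(ε ^ 2 * X * Real.log (1 / δ)) := by
    rw [mul_assoc (ε ^ 2), Real.sqrt_mul (sq_nonneg ε), Real.sqrt_sq hε.le, mul_assoc]
  rw [hε']
  refine dpGD_pcaRank_approx_dp (by omega) hk hA hHc hHconv hHne ν hν η hT hL
    (fun w hw x hx => norm_gradient_le_of_lipschitz hL.le (hLip x hx)
      (fun θ hθ => ⟨(hbd θ hθ).1, (hbd θ hθ).2 x hx⟩) (hHΘ hw))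
    (fun w hw => hsmooth w (hHΘ hw)) hε hβ hδ ?_ (by positivity) hlog hSS' hgap hO
  set a := μ / (L * β) with ha
  have e1 : 8 * μ / (L * β) = 8 * a := by ring
  have e2 : X = 1.05 * (1 + 12.2 ^ 2 * a ^ 2) := by rw [hX, ha]; ring
  rw [e1, e2, mul_div_assoc]
  gcongr
  -- `(1 + 8a)² / 2 ≤ 1 + 64 a²`, and `64 ≤ 1.05 * 12.2 ^ 2`.
  nlinarith [sq_nonneg (1 - 8 * a), sq_nonneg a]
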